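/- Let $n\ge 2$, $k\ge 2$ and $d\ge 1$ be integers. The degree of a permutation $\nu$ of $\{1,\dots,n\}$ is $\deg(\nu)=\#\{\,i\in\{1,\dots,n\} : \nu(i)>\nu(i+1)\,\}$, where $i+1$ is taken modulo $n$ (so $n+1$ means $1$). Let $\mathscr C_{n,d}$ be the set of all $n$-cycles in the symmetric group of $\{1,\dots,n\}$ that have degree $d$, and let $N_{n,d}=\#\,\mathscr C_{n,d}$. Let $\mathbf m_k:\mathbb R/\mathbb Z\to\mathbb R/\mathbb Z$ be the map $\mathbf m_k(x)=kx \pmod{\mathbb Z}$. A period $n$ orbit of $\mathbf m_k$ is the orbit $\mathscr O$ of a periodic point of least period $n$. Such an orbit can be written as $\mathscr O=\{x_1,\dots,x_n\}$ with representatives $0<x_1<x_2<\dots<x_n<1$, and it is said to realize the $n$-cycle $\nu$ if $\mathbf m_k(x_i)=x_{\nu(i)}$ for all $1\le i\le n$. Then the number of period $n$ orbits of $\mathbf m_k$ that realize some element of $\mathscr C_{n,d}$ is finite and equal to $$ \frac{k-1}{n}\binom{n+k-d-1}{n-1}N_{n,d}, $$ where the binomial coefficient is $0$ if $d>k$. 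-/

import Mathlib

/-- The multiplication-by-`k` endomorphism `x ↦ k x (mod ℤ)` of the circle `ℝ / ℤ`. -/
def circleMul (k : ℕ) (x : UnitAddCircle) : UnitAddCircle := k • x

/-- `O` is a period `n` orbit of multiplication by `k`: the forward orbit of a point of exact
(least) period `n`. The theorem uses this for `n ≥ 2` only, where a point of minimal period `n` is
really periodic. -/
def IsPeriodOrbit (k n : ℕ) (O : Set UnitAddCircle) : Prop :=
  ∃ x : UnitAddCircle, Function.minimalPeriod (circleMul k) x = n ∧
    O = Set.range fun j : ℕ => (circleMul k)^[j] x

/-- `O = {x₁, …, xₙ}` with representatives `0 < x₁ < ⋯ < xₙ < 1`, and multiplication by `k` sends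
`xᵢ` to `x_{ν(i)}` for all `i`. The indices `1, …, n` are here `0, …, n - 1`, the elements of
`Fin n`. -/
def Realizes (k : ℕ) {n : ℕ} (O : Set UnitAddCircle) (ν : Equiv.Perm (Fin n)) : Prop :=
  ∃ x : Fin n → ℝ, StrictMono x ∧ (∀ i, 0 < x i ∧ x i < 1) ∧
    O = Set.range (fun i => (x i : UnitAddCircle)) ∧
    ∀ i, circleMul k (x i : UnitAddCircle) = (x (ν i) : UnitAddCircle)

/-- The degree (cyclic descent number) `#{i : ν(i) > ν(i + 1)}`, with `i` taken modulo `n`;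
`finRotate n` is the map `i ↦ i + 1` modulo `n`. -/
def degree {n : ℕ} (ν : Equiv.Perm (Fin n)) : ℕ :=
  (Finset.univ.filter fun i : Fin n => ν (finRotate n i) < ν i).card

/-- The set of all `n`-cycles of degree `d` (for `n ≥ 2`): one cycle that moves every index. -/
def cyclesOfDegree (n d : ℕ) : Set (Equiv.Perm (Fin n)) :=
  {ν | ν.IsCycle ∧ ν.support = Finset.univ ∧ degree ν = d}

/-- `N_{n,d}`, the number of `n`-cycles of degree `d`. -/
noncomputable def numCycles (n d : ℕ) : ℕ := (cyclesOfDegree n d).ncard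

/-- The set of period `n` orbits of multiplication by `k` that realize some `n`-cycle of
degree `d`. -/
def realizingOrbits (k n d : ℕ) : Set (Set UnitAddCircle) :=
  {O | IsPeriodOrbit k n O ∧ ∃ ν ∈ cyclesOfDegree n d, Realizes k O ν}

/-! Write an orbit as `k * x i = x (ν i) + a i` with integer digits `a i`. The order of the points
forces `a` to increase weakly, and strictly wherever `ν` reverses the order (`realizes_iff`).
Conversely, for a full cycle `ν` each such `a` comes from exactly one orbit (`exists_isLift`,
`solution_unique`), and the orbit determines both `ν` and `a` (`IsLift.eq_of_range_eq`).

Adding to each digit the number of earlier ascents of `ν` makes the sequence strictly increasing, so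
`ncard_digitSeqs` is a binomial coefficient. In degree `d` it is `(n + k - d).choose n` if the last
index is a cyclic descent, and `(n + k - d - 1).choose n` otherwise.

Conjugation by rotations preserves the cycles of degree `d`. Averaging over it shows that the first
case has proportion `(d - 1) / n` (`mul_card_cycles_descent_last`), and Pascal's rule merges the two
cases. -/

/-! ### Cyclic descents and conjugation by rotations -/

theorem Fin.intCast_val_sub {m : ℕ} (a b : Fin (m + 1)) :
    ((a - b).val : ℤ) = a.val - b.val + (m + 1) * (if a < b then 1 else 0) := by
  split_ifs with h
  · rw [Fin.coe_sub_iff_lt.2 h]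
    have := b.isLt
    omega
  · rw [Fin.sub_val_of_le (not_lt.1 h)]
    have := Fin.le_def.1 (not_lt.1 h)
    omega

/-- The cyclic steps of a closed path in `ℤ / (m + 1)` add up to `m + 1` times the number of
descents. -/
theorem sum_val_sub_eq_mul_card {m : ℕ} (f : Fin (m + 1) → Fin (m + 1)) :
    ∑ i, ((f (i + 1) - f i).val : ℤ) =
      (m + 1) * (Finset.univ.filter fun i => f (i + 1) < f i).card := by
  simp_rw [Fin.intCast_val_sub]
  have h : ∑ i, ((f (i + 1)).val : ℤ) = ∑ i, ((f i).val : ℤ) :=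
    Equiv.sum_comp (Equiv.addRight (1 : Fin (m + 1))) fun i => ((f i).val : ℤ)
  rw [Finset.sum_add_distrib, Finset.sum_sub_distrib, h, sub_self, zero_add, ← Finset.mul_sum,
    Finset.sum_boole]

theorem sum_val_sub_eq_mul_degree {m : ℕ} (ν : Equiv.Perm (Fin (m + 1))) :
    ∑ i, ((ν (i + 1) - ν i).val : ℤ) = (m + 1) * degree ν := by
  rw [sum_val_sub_eq_mul_card]
  simp [degree]

/-- Conjugation of a permutation of `ℤ / (m + 1)` by a rotation. -/
def rotConj {m : ℕ} (s : Fin (m + 1)) : Equiv.Perm (Fin (m + 1)) ≃ Equiv.Perm (Fin (m + 1)) :=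
  (MulAut.conj (Equiv.subRight s)).toEquiv

theorem rotConj_apply {m : ℕ} (s : Fin (m + 1)) (ν : Equiv.Perm (Fin (m + 1)))
    (i : Fin (m + 1)) : rotConj s ν i = ν (i + s) - s := rfl

/-- A rotation only permutes the cyclic steps `ν (i + 1) - ν i`, whose sum is `m + 1` times the
degree. -/
theorem degree_rotConj {m : ℕ} (s : Fin (m + 1)) (ν : Equiv.Perm (Fin (m + 1))) :
    degree (rotConj s ν) = degree ν := by
  have h : ∑ i, ((rotConj s ν (i + 1) - rotConj s ν i).val : ℤ) =
      ∑ i, ((ν (i + 1) - ν i).val : ℤ) := by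
    rw [← Equiv.sum_comp (Equiv.addRight s) fun i => ((ν (i + 1) - ν i).val : ℤ)]
    refine Finset.sum_congr rfl fun i _ => ?_
    simp only [rotConj_apply, Equiv.coe_addRight, sub_sub_sub_cancel_right]
    rw [add_right_comm]
  rw [sum_val_sub_eq_mul_degree, sum_val_sub_eq_mul_degree] at h
  have := mul_left_cancel₀ (by positivity) h
  exact_mod_cast this

theorem rotConj_mem_cyclesOfDegree {m d : ℕ} (s : Fin (m + 1)) (ν : Equiv.Perm (Fin (m + 1))) :
    rotConj s ν ∈ cyclesOfDegree (m + 1) d ↔ ν ∈ cyclesOfDegree (m + 1) d := by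
  have hc : (rotConj s ν).IsCycle ↔ ν.IsCycle := by
    refine ⟨fun h => ?_, fun h => h.conj⟩
    have := h.conj (g := (Equiv.subRight s)⁻¹)
    simpa [rotConj, mul_assoc] using this
  have hs : (rotConj s ν).support = Finset.univ ↔ ν.support = Finset.univ := by
    simp only [Finset.eq_univ_iff_forall, Equiv.Perm.mem_support, rotConj_apply]
    refine ⟨fun h i => ?_, fun h i => ?_⟩
    · have := h (i - s)
      rwa [sub_add_cancel, Ne, sub_left_inj] at this
    · rw [Ne, sub_eq_iff_eq_add]
      exact h _
  simp only [cyclesOfDegree, Set.mem_ofPred_eq, hc, hs, degree_rotConj]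

/-- A derangement of degree `d` has `d - 1` rotations with a descent at the last index. -/
theorem card_rotConj_descent_add_one {m : ℕ} (ν : Equiv.Perm (Fin (m + 1)))
    (hν : ∀ i, ν i ≠ i) :
    (Finset.univ.filter fun s => rotConj s ν 0 < rotConj s ν (Fin.last m)).card + 1 =
      degree ν := by
  -- Compare consecutive displacements `ν s - s`: these are nonzero, so subtracting 1 does not wrap
  -- around. Summed over `s`, their differences cancel, and the terms `1` account for the extra
  -- descent.
  have hstep (s : Fin (m + 1)) : ((ν (s + 1) - ν s).val : ℤ) =
      (ν (s + 1) - (s + 1)).val - (ν s - s).val + 1 +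
        (m + 1) * (if rotConj (s + 1) ν 0 < rotConj (s + 1) ν (Fin.last m) then 1 else 0) := by
    have h0 : rotConj (s + 1) ν 0 = ν (s + 1) - (s + 1) := by rw [rotConj_apply, zero_add]
    have h1 : rotConj (s + 1) ν (Fin.last m) = ν s - s - 1 := by
      rw [rotConj_apply, sub_sub, show Fin.last m + (s + 1) = s by
        rw [add_comm s, ← add_assoc, Fin.last_add_one, zero_add]]
    have h2 : ((ν s - s - 1).val : ℤ) = (ν s - s).val - 1 := by
      have hne : ν s - s ≠ 0 := sub_ne_zero.2 (hν s)
      rw [Fin.val_sub_one_of_ne_zero hne]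
      have : (ν s - s).val ≠ 0 := fun h => hne (Fin.ext h)
      omega
    have h3 : ν (s + 1) - ν s = (ν (s + 1) - (s + 1)) - (ν s - s - 1) := by abel
    rw [h0, h1, h3, Fin.intCast_val_sub, h2]
    ring
  have hsum := sum_val_sub_eq_mul_degree ν
  have hshift : ∑ s, ((ν (s + 1) - (s + 1)).val : ℤ) = ∑ s, ((ν s - s).val : ℤ) :=
    Equiv.sum_comp (Equiv.addRight (1 : Fin (m + 1))) fun s => ((ν s - s).val : ℤ)
  have hshift' : ∑ s, (if rotConj (s + 1) ν 0 < rotConj (s + 1) ν (Fin.last m) then (1 : ℤ)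
      else 0) = ∑ s, (if rotConj s ν 0 < rotConj s ν (Fin.last m) then (1 : ℤ) else 0) :=
    Equiv.sum_comp (Equiv.addRight (1 : Fin (m + 1))) fun s =>
      if rotConj s ν 0 < rotConj s ν (Fin.last m) then (1 : ℤ) else 0
  simp_rw [hstep] at hsum
  rw [Finset.sum_add_distrib, Finset.sum_add_distrib, Finset.sum_sub_distrib, hshift, sub_self,
    zero_add, ← Finset.mul_sum, hshift', Finset.sum_boole, Finset.sum_const, Finset.card_univ,
    Fintype.card_fin] at hsum
  have h : ((m : ℤ) + 1) * ((Finset.univ.filter fun s =>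
      rotConj s ν 0 < rotConj s ν (Fin.last m)).card + 1) = (m + 1) * degree ν := by
    rw [← hsum]
    simp
    ring
  have := mul_left_cancel₀ (by positivity) h
  exact_mod_cast this

open Classical in
/-- Among the `n`-cycles of degree `d`, a proportion `(d - 1) / n` has a descent at the last
index. -/
theorem mul_card_cycles_descent_last {m d : ℕ} (hd : 1 ≤ d) :
    (m + 1) * (Finset.univ.filter fun ν : Equiv.Perm (Fin (m + 1)) =>
        ν ∈ cyclesOfDegree (m + 1) d ∧ ν 0 < ν (Fin.last m)).card =
      (d - 1) * (Finset.univ.filter fun ν => ν ∈ cyclesOfDegree (m + 1) d).card := by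
  have h1 (s : Fin (m + 1)) : (Finset.univ.filter fun ν =>
      ν ∈ cyclesOfDegree (m + 1) d ∧ rotConj s ν 0 < rotConj s ν (Fin.last m)).card =
      (Finset.univ.filter fun ν : Equiv.Perm (Fin (m + 1)) =>
        ν ∈ cyclesOfDegree (m + 1) d ∧ ν 0 < ν (Fin.last m)).card :=
    Finset.card_equiv (rotConj s) fun ν => by simp [rotConj_mem_cyclesOfDegree]
  have h2 (ν : Equiv.Perm (Fin (m + 1))) (hν : ν ∈ cyclesOfDegree (m + 1) d) :
      (Finset.univ.filter fun s => rotConj s ν 0 < rotConj s ν (Fin.last m)).card = d - 1 := by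
    have := card_rotConj_descent_add_one ν fun i => by
      rw [← Equiv.Perm.mem_support, hν.2.1]
      exact Finset.mem_univ i
    have := hν.2.2
    omega
  -- Double count the pairs (rotation, cycle) whose conjugate has a descent at the last index.
  have h3 := Finset.sum_card_bipartiteAbove_eq_sum_card_bipartiteBelow
    (s := (Finset.univ : Finset (Fin (m + 1))))
    (t := Finset.univ.filter fun ν => ν ∈ cyclesOfDegree (m + 1) d)
    fun s ν => rotConj s ν 0 < rotConj s ν (Fin.last m)
  simp only [Finset.bipartiteAbove, Finset.bipartiteBelow, Finset.filter_filter] at h3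
  rw [Finset.sum_congr rfl fun s _ => h1 s,
    Finset.sum_congr rfl fun ν hν => h2 ν (Finset.mem_filter.1 hν).2] at h3
  simpa [mul_comm] using h3

/-! ### Counting digit sequences -/

/-- The admissible digit sequences of a permutation: monotone, and strictly increasing wherever
the permutation has a descent. -/
def digitSeqs (k : ℕ) {n : ℕ} (ν : Equiv.Perm (Fin n)) : Set (Fin n → ℕ) :=
  {a | (∀ i, a i < k) ∧ ∀ i j, i < j → a i ≤ a j ∧ (ν j < ν i → a i < a j)}

theorem digitSeqs_finite (k : ℕ) {n : ℕ} (ν : Equiv.Perm (Fin n)) : (digitSeqs k ν).Finite :=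
  (Set.Finite.pi' fun _ => Set.finite_Iio k).subset fun _ ha => ha.1

/-- Adjacent conditions suffice: on a stretch where `a` is constant `ν` has no descent, hence
increases. -/
theorem mem_digitSeqs_succ {k m : ℕ} {ν : Equiv.Perm (Fin (m + 1))} {a : Fin (m + 1) → ℕ} :
    a ∈ digitSeqs k ν ↔ a (Fin.last m) < k ∧ ∀ i : Fin m, a i.castSucc ≤ a i.succ ∧
      (ν i.succ < ν i.castSucc → a i.castSucc < a i.succ) := by
  refine ⟨fun h => ⟨h.1 _, fun i => h.2 _ _ i.castSucc_lt_succ⟩, fun ⟨hk, h⟩ => ?_⟩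
  have hm : Monotone a := Fin.monotone_iff_le_succ.2 fun i => (h i).1
  refine ⟨fun i => (hm (Fin.le_last i)).trans_lt hk, fun i j hij => ⟨hm hij.le, fun hν => ?_⟩⟩
  by_contra hlt
  have heq : a i = a j := le_antisymm (hm hij.le) (not_lt.1 hlt)
  have key (t : Fin (m + 1)) : i ≤ t → t ≤ j → ν i ≤ ν t := by
    induction t using Fin.induction with
    | zero => exact fun hi _ => (le_antisymm hi (Fin.zero_le _)) ▸ le_rfl
    | succ t ih =>
      intro hi hj
      rcases hi.eq_or_lt with rfl | hi
      · exact le_rfl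
      have hit : i ≤ t.castSucc := Fin.le_castSucc_iff.2 hi
      have htj : t.castSucc ≤ j := t.castSucc_lt_succ.le.trans hj
      refine (ih hit htj).trans (not_lt.1 fun hdesc => ?_)
      have h1 := hm hit
      have h2 := (h t).2 hdesc
      have h3 := hm hj
      omega
  exact (key j hij.le le_rfl).not_gt hν

theorem ncard_strictMono_lt (n M : ℕ) :
    {s : Fin n → ℕ | StrictMono s ∧ ∀ i, s i < M}.ncard = M.choose n := by
  rw [← Finset.card_range M, ← Finset.card_powersetCard n, Finset.card_range,
    ← Set.ncard_coe_finset]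
  refine Set.ncard_congr (fun s _ => Finset.univ.image s) ?_ ?_ ?_
  · rintro s ⟨hs, hM⟩
    simp only [Finset.mem_coe, Finset.mem_powersetCard]
    refine ⟨fun x hx => ?_, ?_⟩
    · obtain ⟨i, -, rfl⟩ := Finset.mem_image.1 hx
      exact Finset.mem_range.2 (hM i)
    · rw [Finset.card_image_of_injective _ hs.injective, Finset.card_fin]
  · rintro s t ⟨hs, -⟩ ⟨ht, -⟩ hst
    refine (StrictMono.range_inj hs ht).1 ?_
    simpa using congrArg (fun u : Finset ℕ => (u : Set ℕ)) hst
  · intro u hu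
    simp only [Finset.mem_coe, Finset.mem_powersetCard] at hu
    refine ⟨u.orderEmbOfFin hu.2, ⟨(u.orderEmbOfFin hu.2).strictMono, fun i => ?_⟩, ?_⟩
    · exact Finset.mem_range.1 (hu.1 (Finset.orderEmbOfFin_mem u hu.2 i))
    · exact Finset.image_orderEmbOfFin_univ u hu.2

/-- The number of ascents of `ν` at positions before `i`. -/
def ascentsBefore {m : ℕ} (ν : Equiv.Perm (Fin (m + 1))) (i : Fin (m + 1)) : ℕ :=
  (Finset.univ.filter fun j : Fin m => j.castSucc < i ∧ ν j.castSucc < ν j.succ).card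

theorem ascentsBefore_succ {m : ℕ} (ν : Equiv.Perm (Fin (m + 1))) (i : Fin m) :
    ascentsBefore ν i.succ =
      ascentsBefore ν i.castSucc + if ν i.castSucc < ν i.succ then 1 else 0 := by
  have hs (j : Fin m) : j.castSucc < i.succ ↔ j.castSucc < i.castSucc ∨ j = i := by
    simp only [Fin.lt_def, Fin.ext_iff, Fin.val_castSucc, Fin.val_succ]
    omega
  unfold ascentsBefore
  split_ifs with h
  · rw [← Finset.card_insert_of_notMem (a := i) (by simp)]
    congr 1
    ext j
    simp only [Finset.mem_filter, Finset.mem_univ, true_and, Finset.mem_insert, hs]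
    constructor
    · tauto
    · rintro (rfl | h')
      · exact ⟨Or.inr rfl, h⟩
      · tauto
  · rw [add_zero]
    congr 1
    ext j
    simp only [Finset.mem_filter, Finset.mem_univ, true_and, hs]
    constructor
    · rintro ⟨h1 | rfl, h2⟩
      · exact ⟨h1, h2⟩
      · exact absurd h2 h
    · tauto

theorem ncard_digitSeqs (k : ℕ) {m : ℕ} (ν : Equiv.Perm (Fin (m + 1))) :
    (digitSeqs k ν).ncard = (k + ascentsBefore ν (Fin.last m)).choose (m + 1) := by
  rw [← ncard_strictMono_lt]
  have hne (i : Fin m) : ν i.castSucc ≠ ν i.succ := ν.injective.ne i.castSucc_lt_succ.ne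
  refine Set.ncard_congr (fun a _ i => a i + ascentsBefore ν i) ?_ ?_ ?_
  · intro a ha
    rw [mem_digitSeqs_succ] at ha
    have hs : StrictMono fun i => a i + ascentsBefore ν i := by
      refine Fin.strictMono_iff_lt_succ.2 fun i => ?_
      have h1 := ha.2 i
      have h2 := ascentsBefore_succ ν i
      rcases (hne i).lt_or_gt with h | h
      · rw [if_pos h] at h2
        omega
      · rw [if_neg h.not_gt] at h2
        have := h1.2 h
        omega
    refine ⟨hs, fun i => (hs.monotone (Fin.le_last i)).trans_lt ?_⟩
    exact Nat.add_lt_add_right ha.1 _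
  · intro a b _ _ hab
    ext i
    exact Nat.add_right_cancel (congrFun hab i)
  · rintro s ⟨hs, hM⟩
    -- `ascentsBefore` grows by at most 1 per step and `s` by at least 1, so the subtraction below
    -- does not truncate.
    have hle (i : Fin (m + 1)) : ascentsBefore ν i ≤ s i := by
      induction i using Fin.induction with
      | zero => simp [ascentsBefore]
      | succ i ih =>
        have h1 := ascentsBefore_succ ν i
        have h2 := hs i.castSucc_lt_succ
        split_ifs at h1 <;> omega
    refine ⟨fun i => s i - ascentsBefore ν i, ?_, funext fun i => Nat.sub_add_cancel (hle i)⟩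
    refine mem_digitSeqs_succ.2 ⟨?_, fun i => ?_⟩
    · have := hM (Fin.last m)
      have := hle (Fin.last m)
      omega
    · have h1 := ascentsBefore_succ ν i
      have h2 : s i.castSucc < s i.succ := hs i.castSucc_lt_succ
      have h3 := hle i.castSucc
      have h4 := hle i.succ
      rcases (hne i).lt_or_gt with h | h
      · rw [if_pos h] at h1
        exact ⟨by omega, fun h' => absurd h' h.not_gt⟩
      · rw [if_neg h.not_gt] at h1
        exact ⟨by omega, fun _ => by omega⟩

theorem ascentsBefore_last_add_degree {m : ℕ} (ν : Equiv.Perm (Fin (m + 1))) :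
    ascentsBefore ν (Fin.last m) + degree ν =
      m + if ν 0 < ν (Fin.last m) then 1 else 0 := by
  have h1 : degree ν = (Finset.univ.filter fun i : Fin m => ¬ ν i.castSucc < ν i.succ).card +
      if ν 0 < ν (Fin.last m) then 1 else 0 := by
    simp only [degree, finRotate_apply, Finset.card_filter, Fin.sum_univ_castSucc,
      Fin.last_add_one, Fin.coeSucc_eq_succ]
    congr 1
    refine Finset.sum_congr rfl fun i _ => ?_
    have : ν i.castSucc ≠ ν i.succ := ν.injective.ne i.castSucc_lt_succ.ne
    simp only [not_lt, this.symm.le_iff_lt]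
  have h2 : ascentsBefore ν (Fin.last m) =
      (Finset.univ.filter fun i : Fin m => ν i.castSucc < ν i.succ).card := by
    simp [ascentsBefore, Fin.castSucc_lt_last]
  have h3 := Finset.card_filter_add_card_filter_not (s := (Finset.univ : Finset (Fin m)))
    fun i => ν i.castSucc < ν i.succ
  rw [Finset.card_fin] at h3
  omega

/-! ### Digit sequences and orbits -/

theorem coe_unitAddCircle_injOn {s t : ℝ} (hs : 0 < s ∧ s < 1) (ht : 0 < t ∧ t < 1)
    (h : (s : UnitAddCircle) = t) : s = t :=
  (AddCircle.coe_eq_coe_iff_of_mem_Ico (a := (0 : ℝ)) (p := 1)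
    ⟨hs.1.le, by simpa using hs.2⟩ ⟨ht.1.le, by simpa using ht.2⟩).1 h

theorem circleMul_coe_eq_iff {k : ℕ} {s t : ℝ} :
    circleMul k (s : UnitAddCircle) = t ↔ ∃ z : ℤ, k * s = t + z := by
  rw [circleMul, ← AddCircle.coe_nsmul, ← sub_eq_zero, ← AddCircle.coe_sub,
    AddCircle.coe_eq_zero_iff]
  simp only [nsmul_eq_mul, zsmul_eq_mul, mul_one]
  exact exists_congr fun z => ⟨fun h => by linarith, fun h => by linarith⟩

/-- The points `x i ∈ (0, 1)` increase and `k * x i = x (ν i) + a i`. -/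
structure IsLift (k : ℕ) {n : ℕ} (ν : Equiv.Perm (Fin n)) (a : Fin n → ℕ) (x : Fin n → ℝ) :
    Prop where
  strictMono : StrictMono x
  mem : ∀ i, 0 < x i ∧ x i < 1
  map : ∀ i, k * x i = x (ν i) + a i

theorem exists_solution {k n : ℕ} (hk : 2 ≤ k) (hn : n ≠ 0) {ν : Equiv.Perm (Fin n)}
    (hν : ν ^ n = 1) (a : Fin n → ℕ) :
    ∃ x : Fin n → ℝ, ∀ i, k * x i = x (ν i) + a i := by
  have hk1 : (1 : ℝ) < (k : ℝ) ^ n := one_lt_pow₀ (by exact_mod_cast hk) hn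
  -- This is the number with periodic base-`k` digits `a i, a (ν i), …`.
  refine ⟨fun i => (∑ j ∈ Finset.range n, (a ((ν ^ j) i) : ℝ) * k ^ (n - 1 - j)) / (k ^ n - 1),
    fun i => ?_⟩
  have hne : (k : ℝ) ^ n - 1 ≠ 0 := by linarith
  have h : k * ∑ j ∈ Finset.range n, (a ((ν ^ j) i) : ℝ) * k ^ (n - 1 - j) =
      ∑ j ∈ Finset.range n, (a ((ν ^ j) (ν i)) : ℝ) * k ^ (n - 1 - j) +
        a i * (k ^ n - 1) := by
    have h1 : k * ∑ j ∈ Finset.range n, (a ((ν ^ j) i) : ℝ) * k ^ (n - 1 - j) =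
        ∑ j ∈ Finset.range n, (a ((ν ^ j) i) : ℝ) * k ^ (n - j) := by
      rw [Finset.mul_sum]
      refine Finset.sum_congr rfl fun j hj => ?_
      rw [Finset.mem_range] at hj
      rw [show n - j = n - 1 - j + 1 by omega, pow_succ]
      ring
    have h2 : ∑ j ∈ Finset.range n, (a ((ν ^ j) (ν i)) : ℝ) * k ^ (n - 1 - j) =
        ∑ j ∈ Finset.range n, (a ((ν ^ (j + 1)) i) : ℝ) * k ^ (n - (j + 1)) := by
      refine Finset.sum_congr rfl fun j _ => ?_
      rw [pow_succ, Equiv.Perm.mul_apply, Nat.sub_sub, add_comm 1 j]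
    have h3 := Finset.sum_range_succ (fun j => (a ((ν ^ j) i) : ℝ) * k ^ (n - j)) n
    rw [Finset.sum_range_succ'] at h3
    simp only [hν, pow_zero, Equiv.Perm.one_apply, Nat.sub_zero, Nat.sub_self, mul_one] at h3
    rw [h1, h2]
    linarith
  rw [mul_div_assoc', h, add_div, mul_div_assoc, div_self hne, mul_one]

/-- Where `|x - y|` is maximal, `k` times it is again a value of `|x - y|`, so the maximum is 0. -/
theorem solution_unique {k n : ℕ} (hk : 2 ≤ k) {ν : Equiv.Perm (Fin n)}
    {a : Fin n → ℕ} {x y : Fin n → ℝ} (hx : ∀ i, k * x i = x (ν i) + a i)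
    (hy : ∀ i, k * y i = y (ν i) + a i) : x = y := by
  have hk' : (2 : ℝ) ≤ k := by exact_mod_cast hk
  funext i
  have : Nonempty (Fin n) := ⟨i⟩
  obtain ⟨j, hj⟩ := Finite.exists_max fun i => |x i - y i|
  have h : (k : ℝ) * |x j - y j| = |x (ν j) - y (ν j)| := by
    rw [← Nat.abs_cast k, ← abs_mul]
    congr 1
    linarith [hx j, hy j]
  have h1 := hj (ν j)
  have h2 := hj i
  have h3 := abs_nonneg (x j - y j)
  have h4 : |x i - y i| = 0 := le_antisymm (by nlinarith) (abs_nonneg _)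
  linarith [abs_eq_zero.1 h4]

theorem exists_pow_apply_eq {n : ℕ} {ν : Equiv.Perm (Fin n)} (hc : ν.IsCycle)
    (hs : ν.support = Finset.univ) (i j : Fin n) : ∃ t : ℕ, (ν ^ t) i = j := by
  have h (i : Fin n) : ν i ≠ i := Equiv.Perm.mem_support.1 (hs ▸ Finset.mem_univ i)
  exact hc.exists_pow_eq (h i) (h j)

/-- Constant digits would leave `ν` without inversions, hence the identity. -/
theorem digitSeqs_not_const {k n : ℕ} {ν : Equiv.Perm (Fin n)} (hc : ν.IsCycle)
    {a : Fin n → ℕ} (ha : a ∈ digitSeqs k ν) (c : ℕ) : ¬ ∀ i, a i = c := by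
  intro h
  have hm : StrictMono ν := fun i j hij => by
    by_contra hlt
    have h1 := (ha.2 i j hij).2 (lt_of_le_of_ne (not_lt.1 hlt) (ν.injective.ne hij.ne'))
    rw [h i, h j] at h1
    exact lt_irrefl _ h1
  refine hc.ne_one (Equiv.ext fun i => ?_)
  exact congrFun ((StrictMono.range_inj hm strictMono_id).1 (by simp [ν.surjective.range_eq])) i

/-- Extremal values lie in `[0, 1]`; an endpoint would propagate along the cycle and make the digits
constant. A failure of `x i < x j` for `i < j` forces equal digits and persists under `ν`, but the
cycle takes `j` to the index 0, which has nothing below it. -/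
theorem isLift_of_solution {k n : ℕ} (hk : 2 ≤ k) {ν : Equiv.Perm (Fin n)} (hc : ν.IsCycle)
    (hs : ν.support = Finset.univ) {a : Fin n → ℕ} (ha : a ∈ digitSeqs k ν)
    {x : Fin n → ℝ} (hx : ∀ i, k * x i = x (ν i) + a i) : IsLift k ν a x := by
  have hk' : (2 : ℝ) ≤ k := by exact_mod_cast hk
  have hak (i : Fin n) : (a i : ℝ) ≤ k - 1 := by
    have : a i + 1 ≤ k := ha.1 i
    have : (a i : ℝ) + 1 ≤ k := by exact_mod_cast this
    linarith
  have ha0 (i : Fin n) : (0 : ℝ) ≤ a i := Nat.cast_nonneg _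
  have hnonneg (i : Fin n) : 0 ≤ x i := by
    have : Nonempty (Fin n) := ⟨i⟩
    obtain ⟨j, hj⟩ := Finite.exists_min x
    have := hj (ν j)
    have := hj i
    nlinarith [hx j, ha0 j]
  have hle (i : Fin n) : x i ≤ 1 := by
    have : Nonempty (Fin n) := ⟨i⟩
    obtain ⟨j, hj⟩ := Finite.exists_max x
    have := hj (ν j)
    have := hj i
    nlinarith [hx j, hak j]
  have hpos (i : Fin n) : 0 < x i := by
    refine (hnonneg i).lt_of_ne fun h0 => digitSeqs_not_const hc ha 0 fun j => ?_
    have hstep (l : Fin n) (hl : x l = 0) : x (ν l) = 0 ∧ (a l : ℝ) = 0 := by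
      have h1 := hx l
      rw [hl, mul_zero] at h1
      have h2 := hnonneg (ν l)
      have h3 := ha0 l
      constructor <;> linarith
    have hall (t : ℕ) : x ((ν ^ t) i) = 0 := by
      induction t with
      | zero => exact h0.symm
      | succ t ih => rw [pow_succ']; exact (hstep _ ih).1
    obtain ⟨t, rfl⟩ := exists_pow_apply_eq hc hs i j
    exact_mod_cast (hstep _ (hall t)).2
  have hlt (i : Fin n) : x i < 1 := by
    refine (hle i).lt_of_ne fun h0 => digitSeqs_not_const hc ha (k - 1) fun j => ?_
    have hstep (l : Fin n) (hl : x l = 1) : x (ν l) = 1 ∧ (a l : ℝ) + 1 = k := by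
      have h1 := hx l
      rw [hl, mul_one] at h1
      have h2 := hle (ν l)
      have h3 := hak l
      constructor <;> linarith
    have hall (t : ℕ) : x ((ν ^ t) i) = 1 := by
      induction t with
      | zero => exact h0
      | succ t ih => rw [pow_succ']; exact (hstep _ ih).1
    obtain ⟨t, rfl⟩ := exists_pow_apply_eq hc hs i j
    have : a ((ν ^ t) i) + 1 = k := by exact_mod_cast (hstep _ (hall t)).2
    omega
  have hstep (i j : Fin n) (hij : i < j) (h : x j ≤ x i) : ν i < ν j ∧ a i = a j := by
    have heq : a i = a j := by
      refine le_antisymm (ha.2 i j hij).1 (not_lt.1 fun hl => ?_)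
      have hl' : (a i : ℝ) + 1 ≤ a j := by exact_mod_cast hl
      nlinarith [hx i, hx j, hpos (ν j), hlt (ν i)]
    refine ⟨?_, heq⟩
    by_contra hν
    have := (ha.2 i j hij).2 (lt_of_le_of_ne (not_lt.1 hν) (ν.injective.ne hij.ne'))
    omega
  refine ⟨fun i j hij => ?_, fun i => ⟨hpos i, hlt i⟩, hx⟩
  by_contra hji
  have hall (t : ℕ) : (ν ^ t) i < (ν ^ t) j ∧ x ((ν ^ t) j) ≤ x ((ν ^ t) i) := by
    induction t with
    | zero => exact ⟨hij, not_lt.1 hji⟩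
    | succ t ih =>
      rw [pow_succ', Equiv.Perm.mul_apply, Equiv.Perm.mul_apply]
      obtain ⟨h1, h2⟩ := hstep _ _ ih.1 ih.2
      refine ⟨h1, ?_⟩
      have h3 := hx ((ν ^ t) i)
      have h4 := hx ((ν ^ t) j)
      rw [h2] at h3
      nlinarith [ih.2]
  have : NeZero n := ⟨by rintro rfl; exact i.elim0⟩
  obtain ⟨t, ht⟩ := exists_pow_apply_eq hc hs j 0
  have := (hall t).1
  rw [ht] at this
  exact absurd this (Fin.not_lt_zero _)

theorem orderOf_eq_of_full_cycle {n : ℕ} {ν : Equiv.Perm (Fin n)} (hc : ν.IsCycle)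
    (hs : ν.support = Finset.univ) : orderOf ν = n := by
  rw [hc.orderOf, hs, Finset.card_fin]

theorem exists_isLift {k n : ℕ} (hk : 2 ≤ k) {ν : Equiv.Perm (Fin n)} (hc : ν.IsCycle)
    (hs : ν.support = Finset.univ) {a : Fin n → ℕ} (ha : a ∈ digitSeqs k ν) :
    ∃ x, IsLift k ν a x := by
  have ho := orderOf_eq_of_full_cycle hc hs
  have hn : n ≠ 0 := by
    rintro rfl
    exact hc.ne_one (Subsingleton.elim _ _)
  obtain ⟨x, hx⟩ := exists_solution hk hn (ν := ν) (orderOf_dvd_iff_pow_eq_one.1 ho.dvd) a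
  exact ⟨x, isLift_of_solution hk hc hs ha hx⟩

theorem realizes_iff {k n : ℕ} {O : Set UnitAddCircle} {ν : Equiv.Perm (Fin n)} :
    Realizes k O ν ↔ ∃ a ∈ digitSeqs k ν, ∃ x, IsLift k ν a x ∧
      O = Set.range fun i => (x i : UnitAddCircle) := by
  constructor
  · rintro ⟨x, hm, h01, hO, hx⟩
    simp_rw [circleMul_coe_eq_iff] at hx
    choose z hz using hx
    have hz0 (i : Fin n) : 0 ≤ z i := by
      have : (-1 : ℝ) < z i := by
        nlinarith [hz i, h01 i, h01 (ν i), (Nat.cast_nonneg k : (0 : ℝ) ≤ k)]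
      have : (-1 : ℤ) < z i := by exact_mod_cast this
      omega
    lift z to Fin n → ℕ using hz0
    simp only [Int.cast_natCast] at hz
    refine ⟨z, ⟨fun i => ?_, fun i j hij => ?_⟩, x, ⟨hm, h01, hz⟩, hO⟩
    · have : (z i : ℝ) < k := by
        nlinarith [hz i, h01 i, h01 (ν i), (Nat.cast_nonneg k : (0 : ℝ) ≤ k)]
      exact_mod_cast this
    · have hij' : k * x i ≤ k * x j :=
        mul_le_mul_of_nonneg_left (hm hij).le (Nat.cast_nonneg k)
      constructor
      · have : (z i : ℝ) < z j + 1 := by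
          linarith [hz i, hz j, h01 (ν i), h01 (ν j)]
        exact Nat.lt_succ_iff.1 (by exact_mod_cast this)
      · intro hν
        have : (z i : ℝ) < z j := by linarith [hz i, hz j, hm hν]
        exact_mod_cast this
  · rintro ⟨a, -, x, hx, hO⟩
    exact ⟨x, hx.strictMono, hx.mem, hO, fun i =>
      circleMul_coe_eq_iff.2 ⟨a i, by simpa using hx.map i⟩⟩

theorem IsLift.isPeriodOrbit {k n : ℕ} {ν : Equiv.Perm (Fin n)} (hc : ν.IsCycle)
    (hs : ν.support = Finset.univ) {a : Fin n → ℕ} {x : Fin n → ℝ} (hx : IsLift k ν a x) :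
    IsPeriodOrbit k n (Set.range fun i => (x i : UnitAddCircle)) := by
  obtain ⟨i, hi⟩ := hc.nonempty_support
  have hit (t : ℕ) : (circleMul k)^[t] (x i : UnitAddCircle) = x ((ν ^ t) i) := by
    induction t with
    | zero => rfl
    | succ t ih =>
      rw [Function.iterate_succ_apply', ih, circleMul_coe_eq_iff.2 ⟨a ((ν ^ t) i),
        by simpa using hx.map ((ν ^ t) i)⟩, pow_succ', Equiv.Perm.mul_apply]
  refine ⟨x i, ?_, ?_⟩
  · rw [← orderOf_eq_of_full_cycle hc hs]
    -- The two periods agree because they divide the same `t`.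
    refine Nat.dvd_right_iff_eq.1 fun t => ?_
    rw [← Function.isPeriodicPt_iff_minimalPeriod_dvd, orderOf_dvd_iff_pow_eq_one,
      hc.pow_eq_one_iff, Function.IsPeriodicPt, Function.IsFixedPt, hit]
    refine ⟨fun h => ⟨i, Equiv.Perm.mem_support.1 hi, hx.strictMono.injective
      (coe_unitAddCircle_injOn (hx.mem _) (hx.mem _) h)⟩, ?_⟩
    rintro ⟨j, hj, h⟩
    rw [hc.pow_eq_one_iff.2 ⟨j, hj, h⟩, Equiv.Perm.one_apply]
  · ext y
    constructor
    · rintro ⟨j, rfl⟩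
      obtain ⟨t, rfl⟩ := exists_pow_apply_eq hc hs i j
      exact ⟨t, hit t⟩
    · rintro ⟨t, rfl⟩
      exact ⟨_, (hit t).symm⟩

theorem IsLift.eq_of_range_eq {k n : ℕ} {ν μ : Equiv.Perm (Fin n)} {a b : Fin n → ℕ}
    {x y : Fin n → ℝ} (hx : IsLift k ν a x) (hy : IsLift k μ b y)
    (h : (Set.range fun i => (x i : UnitAddCircle)) = Set.range fun i => (y i : UnitAddCircle)) :
    ν = μ ∧ a = b := by
  have hsub {x y : Fin n → ℝ} (hx : ∀ i, 0 < x i ∧ x i < 1) (hy : ∀ i, 0 < y i ∧ y i < 1)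
      (h : (Set.range fun i => (x i : UnitAddCircle)) ⊆
        Set.range fun i => (y i : UnitAddCircle)) : Set.range x ⊆ Set.range y := by
    rintro _ ⟨i, rfl⟩
    obtain ⟨j, hj⟩ := h ⟨i, rfl⟩
    exact ⟨j, coe_unitAddCircle_injOn (hy j) (hx i) hj⟩
  obtain rfl : x = y := (StrictMono.range_inj hx.strictMono hy.strictMono).1
    ((hsub hx.mem hy.mem h.le).antisymm (hsub hy.mem hx.mem h.ge))
  have hν : ν = μ := by
    ext1 i
    refine hx.strictMono.injective (coe_unitAddCircle_injOn (hx.mem _) (hx.mem _) ?_)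
    exact (circleMul_coe_eq_iff.2 ⟨a i, by simpa using hx.map i⟩).symm.trans
      (circleMul_coe_eq_iff.2 ⟨b i, by simpa using hy.map i⟩)
  subst hν
  refine ⟨rfl, funext fun i => ?_⟩
  have : (a i : ℝ) = b i := by linarith [hx.map i, hy.map i]
  exact_mod_cast this

/-! ### The final count -/

open Classical in
theorem realizingOrbits_finite_and_ncard {k n d : ℕ} (hk : 2 ≤ k) :
    (realizingOrbits k n d).Finite ∧ (realizingOrbits k n d).ncard =
      ∑ ν : Equiv.Perm (Fin n) with ν ∈ cyclesOfDegree n d, (digitSeqs k ν).ncard := by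
  have hex (p : Equiv.Perm (Fin n) × (Fin n → ℕ)) : ∃ x : Fin n → ℝ,
      p.1 ∈ cyclesOfDegree n d → p.2 ∈ digitSeqs k p.1 → IsLift k p.1 p.2 x := by
    by_cases h : p.1 ∈ cyclesOfDegree n d ∧ p.2 ∈ digitSeqs k p.1
    · obtain ⟨x, hx⟩ := exists_isLift hk h.1.1 h.1.2.1 h.2
      exact ⟨x, fun _ _ => hx⟩
    -- A junk value, which makes the choice of lifts total.
    · exact ⟨0, fun h1 h2 => absurd ⟨h1, h2⟩ h⟩
  choose X hX using hex
  let T := (Finset.univ.filter fun ν : Equiv.Perm (Fin n) => ν ∈ cyclesOfDegree n d).sigma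
    fun ν => (digitSeqs_finite k ν).toFinset
  let F (p : Σ _ : Equiv.Perm (Fin n), Fin n → ℕ) : Set UnitAddCircle :=
    Set.range fun i => (X (p.1, p.2) i : UnitAddCircle)
  have hT (p) : p ∈ T ↔ p.1 ∈ cyclesOfDegree n d ∧ p.2 ∈ digitSeqs k p.1 := by simp [T]
  have himage : realizingOrbits k n d = F '' T := by
    ext O
    constructor
    · rintro ⟨-, ν, hν, hO⟩
      obtain ⟨a, ha, x, hx, rfl⟩ := realizes_iff.1 hO
      refine ⟨⟨ν, a⟩, (hT _).2 ⟨hν, ha⟩, ?_⟩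
      rw [solution_unique hk hx.map (hX (ν, a) hν ha).map]
    · rintro ⟨⟨ν, a⟩, hp, rfl⟩
      obtain ⟨hν, ha⟩ := (hT _).1 hp
      have h := hX (ν, a) hν ha
      exact ⟨h.isPeriodOrbit hν.1 hν.2.1, ν, hν, realizes_iff.2 ⟨a, ha, _, h, rfl⟩⟩
  have hinj : Set.InjOn F T := by
    rintro ⟨ν, a⟩ hp ⟨μ, b⟩ hq h
    obtain ⟨hν, ha⟩ := (hT _).1 hp
    obtain ⟨hμ, hb⟩ := (hT _).1 hq
    obtain ⟨rfl, rfl⟩ := (hX (ν, a) hν ha).eq_of_range_eq (hX (μ, b) hμ hb) h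
    rfl
  rw [himage]
  refine ⟨T.finite_toSet.image F, ?_⟩
  rw [hinj.ncard_image, Set.ncard_coe_finset, Finset.card_sigma]
  exact Finset.sum_congr rfl fun ν _ => (Set.ncard_eq_toFinset_card _ _).symm

/-- With `M = m + k - d`, Pascal's rule leaves `A * M.choose m + N * M.choose (m + 1)`; the factors
`(d - 1) / (m + 1)` and `(k - d) / (m + 1)` then add up to `(k - 1) / (m + 1)`. -/
theorem descent_cases_choose_identity {m k d N A : ℕ} (hm : 1 ≤ m) (hd : 1 ≤ d)
    (h : (m + 1) * A = (d - 1) * N) :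
    (A * (m + 1 + k - d).choose (m + 1) + (N - A) * (m + k - d).choose (m + 1) : ℚ) =
      ((k : ℚ) - 1) / (m + 1) * (m + k - d).choose m * N := by
  rcases le_or_gt d (m + k) with hle | hlt
  · obtain ⟨M, hM⟩ : ∃ M, m + k = M + d := ⟨m + k - d, by omega⟩
    rw [show m + 1 + k - d = M + 1 by omega, show m + k - d = M by omega, Nat.choose_succ_succ]
    have h1 : (M.choose (m + 1) : ℚ) * (m + 1) = M.choose m * (k - d) := by
      rcases le_or_gt m M with hmM | hmM
      · have h2 := Nat.choose_succ_right_eq M m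
        have h3 : ((M - m : ℕ) : ℚ) = k - d := by
          rw [Nat.cast_sub hmM]
          have : (m : ℚ) + k = M + d := by exact_mod_cast hM
          linarith
        rw [← h3]
        exact_mod_cast h2
      · rw [Nat.choose_eq_zero_of_lt hmM, Nat.choose_eq_zero_of_lt (by omega)]
        simp
    have h4 : ((m : ℚ) + 1) * A = (d - 1) * N := by
      have : (((m + 1) * A : ℕ) : ℚ) = ((d - 1) * N : ℕ) := congrArg _ h
      rw [Nat.cast_mul, Nat.cast_mul, Nat.cast_sub hd] at this
      simpa using this
    have hne : (m : ℚ) + 1 ≠ 0 := by positivity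
    field_simp
    push_cast
    linear_combination (M.choose m : ℚ) * h4 + (N : ℚ) * h1
  · rw [show m + 1 + k - d = 0 by omega, show m + k - d = 0 by omega,
      Nat.choose_eq_zero_of_lt (by omega : 0 < m), Nat.choose_eq_zero_of_lt (Nat.succ_pos m)]
    simp

theorem ncard_digitSeqs_of_degree (k : ℕ) {m d : ℕ} {ν : Equiv.Perm (Fin (m + 1))}
    (hν : degree ν = d) : (digitSeqs k ν).ncard =
      if ν 0 < ν (Fin.last m) then (m + 1 + k - d).choose (m + 1)
      else (m + k - d).choose (m + 1) := by
  have h := ascentsBefore_last_add_degree ν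
  rw [ncard_digitSeqs]
  split_ifs at h ⊢ <;> congr 1 <;> omega

/-- The subtraction in `n + k - d - 1` is that of `ℕ`; it truncates only if `d ≥ n + k`, and then
the binomial coefficient is `0` because `n - 1 ≥ 1`, as it is for every `d > k`. -/
theorem mainTheorem9 (n k d : ℕ) (hn : 2 ≤ n) (hk : 2 ≤ k) (hd : 1 ≤ d) :
    (realizingOrbits k n d).Finite ∧
      ((realizingOrbits k n d).ncard : ℚ) =
        (((k : ℚ) - 1) / (n : ℚ)) * ((n + k - d - 1).choose (n - 1) : ℚ) *
          (numCycles n d : ℚ) := by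
  classical
  obtain ⟨m, rfl⟩ : ∃ m, n = m + 1 := ⟨n - 1, by omega⟩
  obtain ⟨hfin, hcard⟩ := realizingOrbits_finite_and_ncard (n := m + 1) (d := d) hk
  refine ⟨hfin, ?_⟩
  have hN : numCycles (m + 1) d = (Finset.univ.filter fun ν : Equiv.Perm (Fin (m + 1)) =>
      ν ∈ cyclesOfDegree (m + 1) d).card := by
    rw [numCycles, ← Set.ncard_coe_finset]
    simp
  have hA := mul_card_cycles_descent_last (m := m) hd
  have hsplit := Finset.card_filter_add_card_filter_not
    (s := Finset.univ.filter fun ν : Equiv.Perm (Fin (m + 1)) => ν ∈ cyclesOfDegree (m + 1) d)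
    fun ν => ν 0 < ν (Fin.last m)
  rw [← hN] at hA hsplit
  rw [← Finset.filter_filter] at hA
  rw [hcard, Finset.sum_congr rfl fun ν hν =>
    ncard_digitSeqs_of_degree k (Finset.mem_filter.1 hν).2.2.2, Finset.sum_ite,
    Finset.sum_const, Finset.sum_const, smul_eq_mul, smul_eq_mul,
    show m + 1 + k - d - 1 = m + k - d by omega, Nat.add_sub_cancel, Nat.cast_succ,
    ← descent_cases_choose_identity (by omega) hd hA, ← hsplit]
  push_cast
  ring
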